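/- Let $V=\{1,\dots,n\}$, $n\ge 1$, let $G=(V,E)$ be a tree with root node $1$, and let $\mathrm{Deg}(1)$ be the degree of the root. Let $d\ge 2$. A family of vectors $\{x_v^\star\}_{v\in V}\subset\mathbb{R}^d$ is $(G,s,s')$-sparse if $|\mathrm{Supp}(x_1^\star)|\le s$ and $|\mathrm{Supp}(x_v^\star-x_w^\star)|\le s'$ for every edge $(v,w)\in E$. Given matrices $A_v\in\mathbb{R}^{N_v\times d}$ and $y_v=A_vx_v^\star$, Total Variation Basis Pursuit (TVBP) over $G$ is the problem $$\min_{x_1,\dots,x_n\in\mathbb{R}^d}\ \|x_1\|_1+\sum_{(v,w)\in E}\|x_v-x_w\|_1\quad\text{subject to}\quad A_vx_v=y_v\ \text{ for all } v\in V .$$ A random matrix is called sub-Gaussian with parameters $\beta,\kappa>0$ if its entries are independent and identically distributed with mean zero, variance one and $\mathbb{P}(|A_{ij}|\ge t)\le\beta e^{-\kappa t^2}$ for all $t\ge 0$. For all $\beta,\kappa>0$ there are constants $C,C'>0$, depending only on $\beta$ and $\kappa$, such that the following holds for all $n\ge1$, all trees $G$ on $V$ with root $1$, all $d\ge 2$,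 all integers $s,s'\ge 0$ and all $\epsilon\in(0,1)$. (i) Let $\{x_v^\star\}_{v\in V}$ be $(G,s,s')$-sparse, and let $A_{\mathrm{Root}}\in\mathbb{R}^{N_{\mathrm{Root}}\times d}$ and $A_{\mathrm{Non\text{-}root}}\in\mathbb{R}^{N_{\mathrm{Non\text{-}root}}\times d}$ each be sub-Gaussian with parameters $\beta,\kappa$ (no assumption is made on their joint law). Put $A_1=A_{\mathrm{Root}}/\sqrt{N_{\mathrm{Root}}}$ and $A_v=A_{\mathrm{Non\text{-}root}}/\sqrt{N_{\mathrm{Non\text{-}root}}}$ for $v\ne 1$. If $$N_{\mathrm{Root}}\ \ge\ C\max\{s,\mathrm{Deg}(1)^2s'\}\big(\log d+\log(1/\epsilon)\big)\quad\text{and}\quad N_{\mathrm{Non\text{-}root}}\ \ge\ C\,\mathrm{Deg}(1)^2s'\big(\log d+\log(1/\epsilon)\big),$$ then with probability greater than $1-\epsilon$ the solution of TVBP over $G$ exists, is unique and equals $\{x_v^\star\}_{v\in V}$. (ii) There are sample sizes $N_{\mathrm{Root}},N_{\mathrm{Non\text{-}root}}$ satisfying the two bounds in (i) for which the total number of samples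 is at most $$\sum_{v\in V}N_v\ \le\ C'\big(s+n\,\mathrm{Deg}(1)^2s'\big)\big(\log d+\log(1/\epsilon)\big).$$ -/

import Mathlib

open MeasureTheory ProbabilityTheory

namespace TVBP

/-- The `ℓ¹` norm of a vector of `ℝ^d`. -/
def l1Norm {d : ℕ} (x : Fin d → ℝ) : ℝ := ∑ j, |x j|

/-- The size of the support of a vector of `ℝ^d`. -/
noncomputable def suppCard {d : ℕ} (x : Fin d → ℝ) : ℕ :=
  (Finset.univ.filter fun j => x j ≠ 0).card

/-- `(G, s, s')`-sparsity of a family of signals; the nodes are `Fin n` and the root is `0`. -/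
def IsSparse {n d : ℕ} [NeZero n] (G : SimpleGraph (Fin n)) (s s' : ℕ)
    (x : Fin n → Fin d → ℝ) : Prop :=
  suppCard (x 0) ≤ s ∧ ∀ v w, G.Adj v w → suppCard (x v - x w) ≤ s'

/-- The `ℓ¹` norm of the difference of the models at the two ends of an (unordered) edge. -/
def edgeVariation {n d : ℕ} (x : Fin n → Fin d → ℝ) : Sym2 (Fin n) → ℝ :=
  Sym2.lift ⟨fun v w => l1Norm (x v - x w), fun v w => by
    simp only [l1Norm, Pi.sub_apply]
    exact Finset.sum_congr rfl fun j _ => abs_sub_comm _ _⟩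

/-- The objective: `ℓ¹` norm at the root plus the total variation over the edges of `G`. -/
def objective {n d : ℕ} [NeZero n] (G : SimpleGraph (Fin n)) [DecidableRel G.Adj]
    (x : Fin n → Fin d → ℝ) : ℝ :=
  l1Norm (x 0) + ∑ e ∈ G.edgeFinset, edgeVariation x e

/-- The linear constraints `A_v x_v = y_v` at all nodes. -/
def IsFeasible {n d : ℕ} {N : Fin n → ℕ} (A : ∀ v, Matrix (Fin (N v)) (Fin d) ℝ)
    (y : ∀ v, Fin (N v) → ℝ) (x : Fin n → Fin d → ℝ) : Prop :=
  ∀ v, (A v).mulVec (x v) = y v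

/-- `x` is a solution (a global minimiser) of Total Variation Basis Pursuit over `G`. -/
def IsSolution {n d : ℕ} [NeZero n] (G : SimpleGraph (Fin n)) [DecidableRel G.Adj]
    {N : Fin n → ℕ} (A : ∀ v, Matrix (Fin (N v)) (Fin d) ℝ) (y : ∀ v, Fin (N v) → ℝ)
    (x : Fin n → Fin d → ℝ) : Prop :=
  IsFeasible A y x ∧ ∀ z, IsFeasible A y z → objective G x ≤ objective G z

/-- The number of samples `N_v` held by node `v`. -/
def sampleSize {n : ℕ} [NeZero n] (NRoot NNonRoot : ℕ) (v : Fin n) : ℕ :=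
  if v = 0 then NRoot else NNonRoot

/-- The design matrices: `A_Root / √N_Root` at the root, and the same matrix
`A_NonRoot / √N_NonRoot` at every other node. -/
noncomputable def design {n d : ℕ} [NeZero n] {NRoot NNonRoot : ℕ}
    (ARoot : Matrix (Fin NRoot) (Fin d) ℝ) (ANonRoot : Matrix (Fin NNonRoot) (Fin d) ℝ)
    (v : Fin n) : Matrix (Fin (sampleSize NRoot NNonRoot v)) (Fin d) ℝ :=
  fun i j =>
    if h : v = 0 then
      (1 / √(NRoot : ℝ)) * ARoot (Fin.cast (by simp [sampleSize, h]) i) j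
    else
      (1 / √(NNonRoot : ℝ)) * ANonRoot (Fin.cast (by simp [sampleSize, h]) i) j

/-- A random matrix with i.i.d. sub-Gaussian entries with parameters `β`, `κ`: the entries are
independent, identically distributed, of mean zero and variance one, and their tails satisfy
`P(|A i j| ≥ t) ≤ β exp(-κ t²)` for all `t ≥ 0`. -/
structure IsSubGaussianMatrix {Ω : Type*} [MeasurableSpace Ω] (μ : Measure Ω) (β κ : ℝ)
    {N d : ℕ} (A : Ω → Matrix (Fin N) (Fin d) ℝ) : Prop where
  measurable : ∀ i j, Measurable fun ω => A ω i j
  indep : iIndepFun (fun (p : Fin N × Fin d) ω => A ω p.1 p.2) μ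
  identDistrib : ∀ i j i' j', IdentDistrib (fun ω => A ω i j) (fun ω => A ω i' j') μ μ
  mean_zero : ∀ i j, ∫ ω, A ω i j ∂μ = 0
  variance_one : ∀ i j, variance (fun ω => A ω i j) μ = 1
  tail : ∀ i j (t : ℝ), 0 ≤ t → μ.real {ω | t ≤ |A ω i j|} ≤ β * Real.exp (-κ * t ^ 2)

/-- The lower bounds on the two sample sizes, with constant `C`. -/
def SampleSizesSuffice {n : ℕ} [NeZero n] (C : ℝ) (G : SimpleGraph (Fin n)) [DecidableRel G.Adj]
    (d s s' : ℕ) (ε : ℝ) (NRoot NNonRoot : ℕ) : Prop :=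
  C * max (s : ℝ) ((G.degree 0 : ℝ) ^ 2 * s') * (Real.log d + Real.log (1 / ε)) ≤ NRoot ∧
  C * ((G.degree 0 : ℝ) ^ 2 * s') * (Real.log d + Real.log (1 / ε)) ≤ NNonRoot

end TVBP

/-! The randomness enters only through `Spread K`: kernel vectors satisfy 64 K ‖h‖₂² ≤ ‖h‖₁². By
Cauchy–Schwarz such an h has at most a 1/(8t) share of its ℓ¹ mass on any S with t²|S| ≤ K
(`Spread.sum_abs_le`).

Recovery: let h be the difference of a feasible family and the true one. Each ℓ¹ term of the
objective grows by at least 3/4 of the same term at h, except that the ends of a root edge lie in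
kernels of different matrices, which costs a further ‖h₀‖₁/(2t). With t the root degree these
charges total at most ‖h₀‖₁/2, so the objective grows by a quarter of its value at h
(`objective_add_ge`). On a connected graph that value is positive unless h = 0.

Probability: by Maurey's empirical method (`exists_form_sum_le`), `Spread K` follows from a bound on
the column norms and the lower bound ‖Au‖² ≥ (N/2)‖u‖² on the finitely many sums u of mK+1 signed
basis vectors (`spread_of_signedSum`). For fixed u the lower tail is exponentially small because
squares are nonnegative and the fourth moments are controlled. A union bound over (2d)^(mK+1) sums
then needs N of order K(log d + log(1/ε)). -/

namespace TVBP

/-! ### Moment and tail bounds for independent variables. -/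

section Moments

variable {Ω : Type*} [MeasurableSpace Ω] {μ : Measure Ω}

/-- Currying carries the product law of all entries to the product of the row laws. This makes the
coordinates of `A z` independent. -/
lemma iIndepFun_rows [IsProbabilityMeasure μ] {ι κ : Type*} {X : ι → κ → Ω → ℝ}
    (mX : ∀ i j, Measurable (X i j))
    (h : iIndepFun (fun (p : ι × κ) ω => X p.1 p.2 ω) μ) :
    iIndepFun (fun i ω j => X i j ω) μ := by
  have hs : iIndepFun (fun (p : (_ : ι) × κ) ω => X p.1 p.2 ω) μ :=
    h.precomp (Equiv.sigmaEquivProd ι κ).injective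
  have hr : ∀ i, iIndepFun (X i) μ := fun i =>
    h.precomp (g := fun j => (i, j)) (fun a b hab => (Prod.ext_iff.1 hab).2)
  have : ∀ i j, IsProbabilityMeasure (μ.map (X i j)) :=
    fun i j => Measure.isProbabilityMeasure_map (mX i j).aemeasurable
  rw [iIndepFun_iff_map_fun_eq_infinitePi_map (by fun_prop)] at hs ⊢
  have hc : (MeasurableEquiv.piCurry fun (_ : ι) (_ : κ) => ℝ) ∘ (fun ω p => X p.1 p.2 ω) =
      fun ω i j => X i j ω := by
    ext; simp [Sigma.curry]
  rw [← hc, ← Measure.map_map (by fun_prop) (by fun_prop), hs,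
    Measure.infinitePi_map_piCurry (fun i j => μ.map (X i j))]
  congr 1
  funext i
  exact ((iIndepFun_iff_map_fun_eq_infinitePi_map (fun j => mX i j)).1 (hr i)).symm

/-- Second and fourth moments of a sum of independent centred random variables. -/
lemma sum_moments [IsProbabilityMeasure μ] {ι : Type*} {X : ι → Ω → ℝ} {v : ι → ℝ} {B : ℝ}
    (hB : 3 ≤ B) (mX : ∀ i, Measurable (X i)) (h4 : ∀ i, MemLp (X i) 4 μ)
    (hind : iIndepFun X μ) (h0 : ∀ i, ∫ ω, X i ω ∂μ = 0)
    (h2 : ∀ i, ∫ ω, X i ω ^ 2 ∂μ = v i) (hM : ∀ i, ∫ ω, X i ω ^ 4 ∂μ ≤ B * v i ^ 2)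
    (s : Finset ι) :
    MemLp (fun ω => ∑ i ∈ s, X i ω) 4 μ ∧ ∫ ω, ∑ i ∈ s, X i ω ∂μ = 0 ∧
      ∫ ω, (∑ i ∈ s, X i ω) ^ 2 ∂μ = ∑ i ∈ s, v i ∧
      ∫ ω, (∑ i ∈ s, X i ω) ^ 4 ∂μ ≤ B * (∑ i ∈ s, v i) ^ 2 := by
  classical
  induction s using Finset.induction_on with
  | empty => simp
  | insert a s ha ih =>
    obtain ⟨iL, i0, i2, i4⟩ := ih
    set S : Ω → ℝ := fun ω => ∑ i ∈ s, X i ω with hS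
    have hSm : Measurable S := by fun_prop
    have hI : IndepFun S (X a) μ := by
      have := hind.indepFun_finsetSum_of_notMem mX ha
      convert this using 1
      ext ω; simp [hS]
    have pw : ∀ {f : Ω → ℝ}, MemLp f 4 μ → ∀ p : ℕ, p ≤ 4 → Integrable (fun ω => f ω ^ p) μ := by
      intro f hf p hp
      have h1 : MemLp f p μ := hf.mono_exponent (by exact_mod_cast hp)
      have h3 := h1.integrable_norm_pow' 
      refine h3.mono (hf.aestronglyMeasurable.pow p) ?_
      filter_upwards with ω
      simp
    have hprod : ∀ p q : ℕ, p ≤ 4 → q ≤ 4 → Integrable (fun ω => S ω ^ p * X a ω ^ q) μ ∧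
        ∫ ω, S ω ^ p * X a ω ^ q ∂μ = (∫ ω, S ω ^ p ∂μ) * ∫ ω, X a ω ^ q ∂μ := by
      intro p q hp hq
      have hI' : IndepFun (fun ω => S ω ^ p) (fun ω => X a ω ^ q) μ :=
        hI.comp (φ := fun x => x ^ p) (ψ := fun x => x ^ q) (by fun_prop) (by fun_prop)
      exact ⟨hI'.integrable_mul (pw iL p hp) (pw (h4 a) q hq),
        hI'.integral_fun_mul_eq_mul_integral (pw iL p hp).aestronglyMeasurable
          (pw (h4 a) q hq).aestronglyMeasurable⟩
    have hv : 0 ≤ v a := by rw [← h2 a]; positivity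
    have hq : 0 ≤ ∑ i ∈ s, v i := by rw [← i2]; positivity
    simp_rw [Finset.sum_insert ha, add_comm (X a _), add_comm (v a)]
    change MemLp (fun ω => S ω + X a ω) 4 μ ∧ ∫ ω, (S ω + X a ω) ∂μ = 0 ∧
      ∫ ω, (S ω + X a ω) ^ 2 ∂μ = _ ∧ ∫ ω, (S ω + X a ω) ^ 4 ∂μ ≤ _
    have j0 : ∫ ω, S ω ∂μ = 0 := i0
    refine ⟨iL.add (h4 a), ?_, ?_, ?_⟩
    · rw [integral_add (by simpa using pw iL 1 (by norm_num))
        (by simpa using pw (h4 a) 1 (by norm_num)), j0, h0, add_zero]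
    · have e2 : (fun ω => (S ω + X a ω) ^ 2) =
          (fun ω => S ω ^ 2) + (fun ω => 2 * (S ω ^ 1 * X a ω ^ 1)) + fun ω => X a ω ^ 2 := by
        funext ω; simp only [Pi.add_apply]; ring
      have k1 := hprod 1 1 (by norm_num) (by norm_num)
      have a1 := pw iL 2 (by norm_num)
      have a2 := k1.1.const_mul 2
      have a3 := pw (h4 a) 2 (by norm_num)
      rw [e2, integral_add' (a1.add a2) a3, integral_add' a1 a2, integral_const_mul, k1.2]
      simp only [pow_one]
      rw [j0, h2, i2]; ring
    · have e4 : (fun ω => (S ω + X a ω) ^ 4) =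
          (fun ω => S ω ^ 4) + (fun ω => 4 * (S ω ^ 3 * X a ω ^ 1)) +
            (fun ω => 6 * (S ω ^ 2 * X a ω ^ 2)) + (fun ω => 4 * (S ω ^ 1 * X a ω ^ 3)) +
            fun ω => X a ω ^ 4 := by
        funext ω; simp only [Pi.add_apply]; ring
      have k31 := hprod 3 1 (by norm_num) (by norm_num)
      have k22 := hprod 2 2 (by norm_num) (by norm_num)
      have k13 := hprod 1 3 (by norm_num) (by norm_num)
      have a1 := pw iL 4 (by norm_num)
      have a2 := k31.1.const_mul 4
      have a3 := k22.1.const_mul 6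
      have a4 := k13.1.const_mul 4
      have a5 := pw (h4 a) 4 (by norm_num)
      rw [e4, integral_add' (((a1.add a2).add a3).add a4) a5,
        integral_add' ((a1.add a2).add a3) a4,
        integral_add' (a1.add a2) a3, integral_add' a1 a2, integral_const_mul, integral_const_mul,
        integral_const_mul, k31.2, k22.2, k13.2]
      simp only [pow_one]
      rw [j0, h0, h2, i2]
      -- The odd cross terms vanish, leaving B(q² + v²) + 6qv ≤ B(q + v)²; this is where 3 ≤ B is
      -- needed.
      have := hM a
      nlinarith [mul_nonneg hq hv]

/-- A lower-tail bound for sums of squares of independent random variables with bounded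
kurtosis. -/
lemma measure_sum_sq_le [IsProbabilityMeasure μ] {N : ℕ} {Y : Fin N → Ω → ℝ} {v B : ℝ}
    (hv : 0 < v) (hB : 0 < B) (mY : ∀ i, Measurable (Y i)) (h4 : ∀ i, MemLp (Y i) 4 μ)
    (hind : iIndepFun Y μ) (h2 : ∀ i, ∫ ω, Y i ω ^ 2 ∂μ = v)
    (hM : ∀ i, ∫ ω, Y i ω ^ 4 ∂μ ≤ B * v ^ 2) :
    μ.real {ω | ∑ i, Y i ω ^ 2 ≤ N / 2 * v} ≤ Real.exp (-(N / (8 * B))) := by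
  -- Minimises the exponent per summand, -lv/2 + l²Bv²/2, with minimum -1/(8B).
  set l : ℝ := 1 / (2 * B * v) with hl
  have hlp : 0 < l := by positivity
  -- Follows from exp x ≥ 1 + x + x²/2, since (1 + x + x²/2)(1 - x + x²/2) = 1 + x⁴/4 ≥ 1.
  have hexp : ∀ x : ℝ, 0 ≤ x → Real.exp (-x) ≤ 1 - x + x ^ 2 / 2 := by
    intro x hx
    have := Real.quadratic_le_exp_of_nonneg hx
    rw [Real.exp_neg]
    refine inv_le_of_inv_le₀ ?_ ?_
    · nlinarith [sq_nonneg (x - 1)]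
    · refine le_trans ?_ this
      rw [inv_eq_one_div, div_le_iff₀ (by nlinarith [sq_nonneg (x - 1)])]
      nlinarith [sq_nonneg (x^2)]
  have hint2 : ∀ i, Integrable (fun ω => Y i ω ^ 2) μ := fun i =>
    ((h4 i).mono_exponent (by norm_num : (2 : ENNReal) ≤ 4)).integrable_sq
  have hint4 : ∀ i, Integrable (fun ω => Y i ω ^ 4) μ := fun i => by
    refine (MemLp.integrable_norm_pow' (p := 4) (by exact_mod_cast h4 i)).mono
      ((h4 i).aestronglyMeasurable.pow 4) ?_
    filter_upwards with ω
    simp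
  have hinte : ∀ W : Ω → ℝ, Measurable W → (∀ ω, 0 ≤ W ω) →
      Integrable (fun ω => Real.exp (-l * W ω)) μ := by
    intro W hW hW0
    refine Integrable.mono' (integrable_const 1) (by fun_prop) ?_
    filter_upwards with ω
    rw [Real.norm_eq_abs, Real.abs_exp, Real.exp_le_one_iff]
    have := mul_nonneg hlp.le (hW0 ω)
    linarith
  have hmgf : ∀ i, mgf (fun ω => Y i ω ^ 2) μ (-l) ≤
      Real.exp (-l * v + l ^ 2 * (B * v ^ 2) / 2) := by
    intro i
    have hi2 : Integrable (fun ω => 1 - l * Y i ω ^ 2) μ :=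
      (integrable_const 1).sub ((hint2 i).const_mul l)
    have hi : Integrable (fun ω => 1 - l * Y i ω ^ 2 + l ^ 2 / 2 * Y i ω ^ 4) μ :=
      hi2.add ((hint4 i).const_mul _)
    calc mgf (fun ω => Y i ω ^ 2) μ (-l)
        ≤ ∫ ω, (1 - l * Y i ω ^ 2 + l ^ 2 / 2 * Y i ω ^ 4) ∂μ := by
          refine integral_mono (hinte _ (by fun_prop) fun ω => sq_nonneg _) hi fun ω => ?_
          have := hexp (l * Y i ω ^ 2) (by positivity)
          simp only [neg_mul]
          calc _ ≤ _ := this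
            _ = _ := by ring
      _ = 1 - l * v + l ^ 2 / 2 * ∫ ω, Y i ω ^ 4 ∂μ := by
          rw [integral_add hi2 ((hint4 i).const_mul _),
            integral_sub (integrable_const 1) ((hint2 i).const_mul l),
            integral_const_mul, integral_const_mul, h2]
          simp
      _ ≤ 1 - l * v + l ^ 2 / 2 * (B * v ^ 2) := by
          have := hM i
          gcongr
      _ ≤ _ := by
          have := Real.add_one_le_exp (-l * v + l ^ 2 * (B * v ^ 2) / 2)
          linarith
  have hW : iIndepFun (fun i ω => Y i ω ^ 2) μ :=
    hind.comp (fun _ x => x ^ 2) (fun _ => by fun_prop)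
  have hch := measure_le_le_exp_mul_mgf (μ := μ) (X := ∑ i, fun ω => Y i ω ^ 2) (t := -l)
    (N / 2 * v) (by linarith)
    (hinte _ (by fun_prop) fun ω => by
      rw [Finset.sum_apply]; exact Finset.sum_nonneg fun i _ => sq_nonneg _)
  rw [hW.mgf_sum (fun i => by fun_prop)] at hch
  simp only [Finset.sum_apply] at hch
  refine hch.trans ?_
  calc _ ≤ Real.exp (- -l * (N / 2 * v)) *
        ∏ _i : Fin N, Real.exp (-l * v + l ^ 2 * (B * v ^ 2) / 2) := by
        gcongr with i
        · exact fun i _ => mgf_nonneg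
        · exact hmgf i
    _ = _ := by
        rw [Finset.prod_const, Finset.card_univ, Fintype.card_fin, ← Real.exp_nat_mul,
          ← Real.exp_add, hl]
        congr 1
        field_simp
        ring

/-- Exponential square-integrability of a random variable with Gaussian tails. -/
lemma integral_exp_sq_le [IsProbabilityMeasure μ] {β κ : ℝ} (hβ : 0 < β) (hκ : 0 < κ)
    {X : Ω → ℝ} (mX : Measurable X)
    (htail : ∀ t : ℝ, 0 ≤ t → μ.real {ω | t ≤ |X ω|} ≤ β * Real.exp (-κ * t ^ 2)) :
    Integrable (fun ω => Real.exp (κ / 2 * X ω ^ 2)) μ ∧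
      ∫ ω, Real.exp (κ / 2 * X ω ^ 2) ∂μ ≤ 1 + β := by
  -- Layer cake for exp(κX²/2) - 1. Half the tail rate leaves the integrand (βκ/2) exp(-κt/2), of
  -- total mass β.
  have hlc := lintegral_comp_eq_lintegral_meas_le_mul_of_measurable μ
    (f := fun ω => X ω ^ 2) (g := fun t => κ / 2 * Real.exp (κ / 2 * t))
    (fun ω => sq_nonneg _) (by fun_prop)
    (fun t _ => (by fun_prop : Continuous fun t => κ / 2 * Real.exp (κ / 2 * t)).intervalIntegrable
      _ _) (by fun_prop) (fun t _ => by positivity)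
  have hint : ∀ u : ℝ, ∫ t in (0 : ℝ)..u, κ / 2 * Real.exp (κ / 2 * t) =
      Real.exp (κ / 2 * u) - 1 := by
    intro u
    rw [intervalIntegral.integral_eq_sub_of_hasDerivAt (f := fun t => Real.exp (κ / 2 * t))]
    · simp
    · intro x _
      have := ((hasDerivAt_id x).const_mul (κ / 2)).exp
      simpa [mul_comm] using this
    · exact (by fun_prop : Continuous fun t => κ / 2 * Real.exp (κ / 2 * t)).intervalIntegrable _ _
  simp_rw [hint] at hlc
  have hb : ∫⁻ ω, ENNReal.ofReal (Real.exp (κ / 2 * X ω ^ 2) - 1) ∂μ ≤ ENNReal.ofReal β := by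
    rw [hlc]
    calc _ ≤ ∫⁻ t in Set.Ioi (0 : ℝ), ENNReal.ofReal (β * (κ / 2) * Real.exp (-(κ / 2) * t)) := by
          refine setLIntegral_mono (by fun_prop) fun t ht => ?_
          have ht' : (0 : ℝ) < t := ht
          have h1 : {a | t ≤ X a ^ 2} = {ω | √t ≤ |X ω|} := by
            ext ω
            simp only [Set.mem_ofPred_eq]
            rw [Real.sqrt_le_left (abs_nonneg _), sq_abs]
          have h2 := htail (√t) (Real.sqrt_nonneg _)
          rw [Real.sq_sqrt ht'.le] at h2
          rw [h1, ← ofReal_measureReal, ← ENNReal.ofReal_mul (by positivity)]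
          refine ENNReal.ofReal_le_ofReal ?_
          calc _ ≤ β * Real.exp (-κ * t) * (κ / 2 * Real.exp (κ / 2 * t)) := by gcongr
            _ = β * (κ / 2) * (Real.exp (-κ * t) * Real.exp (κ / 2 * t)) := by ring
            _ = _ := by rw [← Real.exp_add]; congr 2; ring
      _ = ENNReal.ofReal β := by
          rw [← ofReal_integral_eq_lintegral_ofReal]
          · rw [integral_const_mul, integral_exp_mul_Ioi (by linarith)]
            congr 1
            simp
            field_simp
          · exact (integrableOn_exp_mul_Ioi (by linarith) 0).const_mul _
          · exact Filter.Eventually.of_forall fun t => by positivity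
  have hnn : ∀ ω, 0 ≤ Real.exp (κ / 2 * X ω ^ 2) - 1 := fun ω => by
    have : 0 ≤ κ / 2 * X ω ^ 2 := by positivity
    linarith [Real.one_le_exp this]
  have hi : Integrable (fun ω => Real.exp (κ / 2 * X ω ^ 2) - 1) μ := by
    refine ⟨by fun_prop, ?_⟩
    rw [hasFiniteIntegral_iff_ofReal (Filter.Eventually.of_forall hnn)]
    exact hb.trans_lt ENNReal.ofReal_lt_top
  have hi' : Integrable (fun ω => Real.exp (κ / 2 * X ω ^ 2)) μ := by
    refine (hi.add (integrable_const 1)).congr (Filter.Eventually.of_forall fun ω => ?_)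
    simp
  refine ⟨hi', ?_⟩
  have h3 : ∫ ω, (Real.exp (κ / 2 * X ω ^ 2) - 1) ∂μ ≤ β := by
    rw [integral_eq_lintegral_of_nonneg_ae (Filter.Eventually.of_forall hnn) (by fun_prop)]
    exact ENNReal.toReal_le_of_le_ofReal hβ.le hb
  rw [integral_sub hi' (integrable_const 1)] at h3
  simp at h3
  linarith

/-- The fourth moment of a random variable with Gaussian tails. -/
lemma memLp_four_of_tail [IsProbabilityMeasure μ] {β κ : ℝ} (hβ : 0 < β) (hκ : 0 < κ)
    {X : Ω → ℝ} (mX : Measurable X)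
    (htail : ∀ t : ℝ, 0 ≤ t → μ.real {ω | t ≤ |X ω|} ≤ β * Real.exp (-κ * t ^ 2)) :
    MemLp X 4 μ ∧ ∫ ω, X ω ^ 4 ∂μ ≤ 8 / κ ^ 2 * (1 + β) := by
  obtain ⟨hi, hle⟩ := integral_exp_sq_le hβ hκ mX htail
  have hpt : ∀ x : ℝ, x ^ 4 ≤ 8 / κ ^ 2 * Real.exp (κ / 2 * x ^ 2) := by
    intro x
    have := Real.quadratic_le_exp_of_nonneg (x := κ / 2 * x ^ 2) (by positivity)
    rw [div_mul_eq_mul_div, le_div_iff₀ (by positivity)]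
    nlinarith [mul_nonneg hκ.le (sq_nonneg x)]
  have h4 : Integrable (fun ω => X ω ^ 4) μ := by
    refine (hi.const_mul (8 / κ ^ 2)).mono' (by fun_prop) ?_
    filter_upwards with ω
    rw [Real.norm_eq_abs, abs_of_nonneg (by positivity)]
    exact hpt _
  refine ⟨?_, ?_⟩
  · rw [← integrable_norm_rpow_iff mX.aestronglyMeasurable (by norm_num) (by norm_num)]
    refine h4.congr ?_
    filter_upwards with ω
    have : ((4 : ENNReal).toReal) = ((4 : ℕ) : ℝ) := by norm_num
    rw [this, Real.rpow_natCast, Real.norm_eq_abs, Even.pow_abs (by decide)]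
  · calc _ ≤ ∫ ω, 8 / κ ^ 2 * Real.exp (κ / 2 * X ω ^ 2) ∂μ :=
          integral_mono h4 (hi.const_mul _) fun ω => hpt _
      _ = 8 / κ ^ 2 * ∫ ω, Real.exp (κ / 2 * X ω ^ 2) ∂μ := integral_const_mul _ _
      _ ≤ _ := by gcongr

/-- An upper-tail bound for sums of squares of independent sub-Gaussian random variables. -/
lemma measure_le_sum_sq [IsProbabilityMeasure μ] {β κ : ℝ} (hβ : 0 < β) (hκ : 0 < κ) {N : ℕ}
    {X : Fin N → Ω → ℝ} (mX : ∀ i, Measurable (X i)) (hind : iIndepFun X μ)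
    (htail : ∀ i, ∀ t : ℝ, 0 ≤ t → μ.real {ω | t ≤ |X i ω|} ≤ β * Real.exp (-κ * t ^ 2)) :
    μ.real {ω | 2 * (β + 1) / κ * N ≤ ∑ i, X i ω ^ 2} ≤ Real.exp (-N) := by
  have hW : iIndepFun (fun i ω => X i ω ^ 2) μ :=
    hind.comp (fun _ x => x ^ 2) (fun _ => by fun_prop)
  have hmgf : ∀ i, mgf (fun ω => X i ω ^ 2) μ (κ / 2) ≤ Real.exp β := fun i =>
    ((integral_exp_sq_le hβ hκ (mX i) (htail i)).2).trans
      (by linarith [Real.add_one_le_exp β])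
  -- At this threshold the Chernoff exponent is -(β + 1)N + βN = -N.
  have hch := measure_ge_le_exp_mul_mgf (μ := μ) (X := ∑ i, fun ω => X i ω ^ 2) (t := κ / 2)
    (2 * (β + 1) / κ * N) (by linarith)
    (hW.integrable_exp_mul_sum (fun i => by fun_prop)
      fun i _ => (integral_exp_sq_le hβ hκ (mX i) (htail i)).1)
  rw [hW.mgf_sum (fun i => by fun_prop)] at hch
  simp only [Finset.sum_apply] at hch
  refine hch.trans ?_
  calc _ ≤ Real.exp (-(κ / 2) * (2 * (β + 1) / κ * N)) * ∏ _i : Fin N, Real.exp β := by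
        gcongr with i
        · exact fun i _ => mgf_nonneg
        · exact hmgf i
    _ = _ := by
        rw [Finset.prod_const, Finset.card_univ, Fintype.card_fin, ← Real.exp_nat_mul,
          ← Real.exp_add]
        congr 1
        field_simp
        ring

end Moments

/-- Every vector of the kernel of `A` has a Euclidean norm that is small relative to its `ℓ¹`
norm. -/
def Spread {N d : ℕ} (K : ℕ) (A : Matrix (Fin N) (Fin d) ℝ) : Prop :=
  ∀ h : Fin d → ℝ, A.mulVec h = 0 → 64 * (K : ℝ) * ∑ j, h j ^ 2 ≤ l1Norm h ^ 2

/-! ### From finitely many sums of signed basis vectors to the whole kernel. -/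

section EmpiricalMethod

/-- Some value is at most the mean. This replaces the random draw in Maurey's argument. -/
lemma exists_le_weighted_sum {ι : Type*} [Fintype ι] {p φ : ι → ℝ} (hp : ∀ i, 0 ≤ p i)
    (hp1 : ∑ i, p i = 1) : ∃ i, φ i ≤ ∑ j, p j * φ j := by
  by_contra! hc
  set c := ∑ j, p j * φ j with hcdef
  have h0 : ∑ i, p i * (φ i - c) = 0 := by
    simp_rw [mul_sub, Finset.sum_sub_distrib, ← Finset.sum_mul, hp1, one_mul]
    rw [← hcdef, sub_self]
  have h1 := (Finset.sum_eq_zero_iff_of_nonneg fun i _ =>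
    mul_nonneg (hp i) (sub_nonneg.2 (hc i).le)).1 h0
  have h2 : ∑ i, p i = 0 := Finset.sum_eq_zero fun i hi =>
    (mul_eq_zero.1 (h1 i hi)).resolve_right (sub_pos.2 (hc i)).ne'
  linarith

/-- Maurey's empirical method for a quadratic form: some sum of `k` of the vectors `g i` does not
exceed the expectation of the form at a random sum. -/
lemma exists_form_sum_le {ι V : Type*} [Fintype ι] [AddCommGroup V] [Module ℝ V]
    (F : V →ₗ[ℝ] V →ₗ[ℝ] ℝ) (hF : ∀ u v, F u v = F v u) (g : ι → V) {p : ι → ℝ}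
    (hp : ∀ i, 0 ≤ p i) (hp1 : ∑ i, p i = 1) (k : ℕ) (u : V) :
    ∃ f : Fin k → ι, F (u + ∑ i, g (f i)) (u + ∑ i, g (f i)) ≤
      F u u + 2 * k * F u (∑ i, p i • g i) + k * ∑ i, p i * F (g i) (g i) +
        k * (k - 1) * F (∑ i, p i • g i) (∑ i, p i • g i) := by
  set h := ∑ i, p i • g i with hh
  -- Conditional expectations: `u` is the partial sum already chosen, and the bound is the expected
  -- form after k further draws.
  induction k generalizing u with
  | zero => exact ⟨Fin.elim0, by simp⟩
  | succ k ih =>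
    have hFh : ∀ w, F w h = ∑ i, p i * F w (g i) := fun w => by simp [hh, map_sum]
    -- `φ` collects the part of the inductive bound at `u + g i` that depends on `i`.
    obtain ⟨j, hj⟩ := exists_le_weighted_sum
      (φ := fun i => F (u + g i) (u + g i) + 2 * k * F (u + g i) h) hp hp1
    obtain ⟨f, hf⟩ := ih (u + g j)
    refine ⟨Fin.cons j f, ?_⟩
    have e1 : ∑ i, p i * (F (u + g i) (u + g i) + 2 * k * F (u + g i) h) =
        F u u + 2 * F u h + ∑ i, p i * F (g i) (g i) + 2 * k * F u h + 2 * k * F h h := by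
      have : ∀ i, p i * (F (u + g i) (u + g i) + 2 * k * F (u + g i) h) =
          p i * F u u + 2 * (p i * F u (g i)) + p i * F (g i) (g i) + p i * (2 * k * F u h) +
            2 * k * (p i * F h (g i)) := by
        intro i
        simp only [map_add, LinearMap.add_apply]
        rw [hF (g i) u, hF (g i) h]
        ring
      simp_rw [this, Finset.sum_add_distrib, ← Finset.mul_sum, ← Finset.sum_mul, hp1, ← hFh]
      ring
    rw [e1] at hj
    rw [Fin.sum_univ_succ]
    simp only [Fin.cons_zero, Fin.cons_succ, ← add_assoc]
    refine hf.trans ?_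
    push_cast
    nlinarith [hj]

/-- The signed basis vectors of `ℝ^d`. -/
def signedBasis {d : ℕ} (a : Fin d × Bool) : Fin d → ℝ :=
  Pi.single a.1 (if a.2 then 1 else -1)

/-- A sum of signed basis vectors. -/
def signedSum {d k : ℕ} (f : Fin k → Fin d × Bool) : Fin d → ℝ := ∑ i, signedBasis (f i)

lemma signedBasis_sq {d : ℕ} (a : Fin d × Bool) : ∑ j, signedBasis a j ^ 2 = 1 := by
  rw [Finset.sum_eq_single a.1]
  · rcases a with ⟨j, b⟩; cases b <;> simp [signedBasis]
  · intro j _ hj; simp [signedBasis, hj]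
  · simp

lemma mulVec_signedBasis_sq {N d : ℕ} (A : Matrix (Fin N) (Fin d) ℝ) (a : Fin d × Bool)
    (i : Fin N) : (A.mulVec (signedBasis a) i) ^ 2 = A i a.1 ^ 2 := by
  rcases a with ⟨j, b⟩; cases b <;> simp [signedBasis]

lemma l1Norm_nonneg {d : ℕ} (x : Fin d → ℝ) : 0 ≤ l1Norm x :=
  Finset.sum_nonneg fun _ _ => abs_nonneg _

lemma l1Norm_eq_zero {d : ℕ} {x : Fin d → ℝ} : l1Norm x = 0 ↔ x = 0 := by
  rw [l1Norm, Finset.sum_eq_zero_iff_of_nonneg fun _ _ => abs_nonneg _]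
  simp [funext_iff]

/-- The quadratic form `‖A u‖² - N / 2 * ‖u‖²`, polarised. -/
noncomputable def excessForm {N d : ℕ} (A : Matrix (Fin N) (Fin d) ℝ) :
    (Fin d → ℝ) →ₗ[ℝ] (Fin d → ℝ) →ₗ[ℝ] ℝ :=
  LinearMap.mk₂ ℝ
    (fun u v => (∑ i, A.mulVec u i * A.mulVec v i) - (N : ℝ) / 2 * ∑ j, u j * v j)
    (by intro u v w
        simp only [Matrix.mulVec_add, Pi.add_apply, add_mul, Finset.sum_add_distrib]; ring)
    (by intro c u v
        simp only [Matrix.mulVec_smul, Pi.smul_apply, smul_eq_mul, mul_assoc, ← Finset.mul_sum]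
        ring)
    (by intro u v w
        simp only [Matrix.mulVec_add, Pi.add_apply, mul_add, Finset.sum_add_distrib]; ring)
    (by intro c u v
        simp only [Matrix.mulVec_smul, Pi.smul_apply, smul_eq_mul, mul_left_comm _ c,
          ← Finset.mul_sum]
        ring)

lemma excessForm_apply {N d : ℕ} (A : Matrix (Fin N) (Fin d) ℝ) (u v : Fin d → ℝ) :
    excessForm A u v = (∑ i, A.mulVec u i * A.mulVec v i) - (N : ℝ) / 2 * ∑ j, u j * v j := rfl

/-- A lower bound for the quadratic form on sums of signed basis vectors transfers to the
kernel. -/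
lemma spread_of_signedSum {N d K m : ℕ} {A : Matrix (Fin N) (Fin d) ℝ} {D : ℝ} (hN : 0 < N)
    (hD : 0 < D) (hm : 128 * D ≤ m) (hcol : ∀ j, ∑ i, A i j ^ 2 ≤ D * N)
    (hlow : ∀ f : Fin (m * K + 1) → Fin d × Bool,
      (N : ℝ) / 2 * ∑ j, signedSum f j ^ 2 ≤ ∑ i, A.mulVec (signedSum f) i ^ 2) :
    Spread K A := by
  intro h hker
  rcases eq_or_ne h 0 with rfl | hne
  · simp [l1Norm]
  have hL : 0 < l1Norm h :=
    lt_of_le_of_ne (l1Norm_nonneg h) (fun hz => hne (l1Norm_eq_zero.1 hz.symm))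
  set L := l1Norm h with hLdef
  -- Positive and negative parts of h, normalised: h / L is a convex combination of signed basis
  -- vectors.
  set p : Fin d × Bool → ℝ := fun a => (if a.2 then max (h a.1) 0 else max (-h a.1) 0) / L
  have hp : ∀ a, 0 ≤ p a := fun a => by
    simp only [p]
    split_ifs <;> positivity
  have hp1 : ∑ a, p a = 1 := by
    rw [← Finset.sum_div, div_eq_one_iff_eq hL.ne', Fintype.sum_prod_type, hLdef, l1Norm]
    refine Finset.sum_congr rfl fun j _ => ?_
    simp only [Fintype.sum_bool, if_true, Bool.false_eq_true, if_false]
    rcases le_total 0 (h j) with hj | hj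
    · simp [abs_of_nonneg hj, hj]
    · simp [abs_of_nonpos hj, hj]
  have hps : ∑ a, p a • signedBasis a = L⁻¹ • h := by
    ext j
    rw [Finset.sum_apply, Fintype.sum_prod_type, Finset.sum_eq_single j]
    · simp only [Fintype.sum_bool, p, signedBasis, Pi.smul_apply, Pi.single_eq_same, smul_eq_mul,
        if_true, Bool.false_eq_true, if_false]
      rcases le_total 0 (h j) with hj | hj
      · simp [hj]; ring
      · simp [hj]; ring
    · intro i _ hij
      simp [signedBasis, Ne.symm hij]
    · simp
  -- With mK + 1 draws the factor k(k - 1) is (mK + 1)mK, so mK + 1 cancels. On the kernel the form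
  -- is -(N/2)‖h‖², whence mK‖h‖² ≤ 2DL².
  obtain ⟨f, hf⟩ := exists_form_sum_le (excessForm A)
    (fun u v => by simp only [excessForm_apply, mul_comm]) signedBasis hp hp1 (m * K + 1) 0
  rw [zero_add, hps] at hf
  change excessForm A (signedSum f) (signedSum f) ≤ _ at hf
  have h0 : 0 ≤ excessForm A (signedSum f) (signedSum f) := by
    simp only [excessForm_apply, ← sq]
    linarith [hlow f]
  have hNr : (0 : ℝ) < N := by exact_mod_cast hN
  have hσ : ∑ a, p a * excessForm A (signedBasis a) (signedBasis a) ≤ D * N := by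
    calc _ ≤ ∑ a, p a * (D * N) := by
          refine Finset.sum_le_sum fun a _ => mul_le_mul_of_nonneg_left ?_ (hp a)
          simp only [excessForm_apply, ← sq, mulVec_signedBasis_sq, signedBasis_sq]
          linarith [hcol a.1]
      _ = _ := by rw [← Finset.sum_mul, hp1, one_mul]
  have hk : excessForm A h h = -((N : ℝ) / 2 * ∑ j, h j ^ 2) := by
    simp [excessForm_apply, hker, ← sq]
  simp only [map_zero, LinearMap.zero_apply, mul_zero, zero_add, map_smul, LinearMap.smul_apply,
    smul_eq_mul, hk] at hf
  push_cast at hf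
  have hS : 0 ≤ ∑ j, h j ^ 2 := Finset.sum_nonneg fun _ _ => sq_nonneg _
  have hkp : (0 : ℝ) < m * K + 1 := by positivity
  have h1 : 0 ≤ (m * K + 1 : ℝ) * (D * N - m * K * (L⁻¹ * (L⁻¹ * (N / 2 * ∑ j, h j ^ 2)))) := by
    have := mul_le_mul_of_nonneg_left hσ hkp.le
    linarith
  have h2 := nonneg_of_mul_nonneg_right h1 hkp
  have h3 : D * N - m * K * (L⁻¹ * (L⁻¹ * (N / 2 * ∑ j, h j ^ 2))) =
      N / (2 * L ^ 2) * (2 * D * L ^ 2 - m * K * ∑ j, h j ^ 2) := by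
    field_simp
  rw [h3] at h2
  have h4 := nonneg_of_mul_nonneg_right h2 (by positivity)
  have h5 : 128 * D * (K * ∑ j, h j ^ 2) ≤ m * (K * ∑ j, h j ^ 2) := by gcongr
  have h6 : 2 * D * (64 * (K : ℝ) * ∑ j, h j ^ 2) ≤ 2 * D * L ^ 2 := by linarith
  exact le_of_mul_le_mul_left h6 (by positivity)

end EmpiricalMethod

/-! ### Sub-Gaussian matrices have spread kernels. -/

section Probability

variable {Ω : Type*} [MeasurableSpace Ω] {μ : Measure Ω}

lemma IsSubGaussianMatrix.measure_column_le [IsProbabilityMeasure μ] {β κ : ℝ} (hβ : 0 < β)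
    (hκ : 0 < κ) {N d : ℕ} {A : Ω → Matrix (Fin N) (Fin d) ℝ} (hA : IsSubGaussianMatrix μ β κ A)
    (j : Fin d) :
    μ.real {ω | 2 * (β + 1) / κ * N ≤ ∑ i, A ω i j ^ 2} ≤ Real.exp (-N) :=
  measure_le_sum_sq hβ hκ (fun i => hA.measurable i j)
    (hA.indep.precomp (g := fun i => (i, j)) fun _ _ hab => (Prod.ext_iff.1 hab).1)
    (fun i => hA.tail i j)

/-- The coordinates of `A z` are independent with variance ‖z‖² and fourth moment at most B‖z‖⁴, so
`measure_sum_sq_le` applies. -/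
lemma IsSubGaussianMatrix.measure_mulVec_le [IsProbabilityMeasure μ] {β κ : ℝ} (hβ : 0 < β)
    (hκ : 0 < κ) {N d : ℕ} {A : Ω → Matrix (Fin N) (Fin d) ℝ} (hA : IsSubGaussianMatrix μ β κ A)
    (z : Fin d → ℝ) :
    μ.real {ω | ∑ i, (A ω).mulVec z i ^ 2 < N / 2 * ∑ j, z j ^ 2} ≤
      Real.exp (-(N / (8 * (3 + 8 / κ ^ 2 * (1 + β))))) := by
  set B : ℝ := 3 + 8 / κ ^ 2 * (1 + β)
  have hB : 3 ≤ B := by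
    have : 0 ≤ 8 / κ ^ 2 * (1 + β) := by positivity
    linarith
  rcases eq_or_ne z 0 with rfl | hz
  · simp [Real.exp_nonneg]
  have hv : 0 < ∑ j, z j ^ 2 := by
    obtain ⟨j, hj⟩ := Function.ne_iff.1 hz
    exact Finset.sum_pos' (fun _ _ => sq_nonneg _) ⟨j, Finset.mem_univ _, by
      have : z j ≠ 0 := hj
      positivity⟩
  have h4 : ∀ i j, MemLp (fun ω => A ω i j) 4 μ := fun i j =>
    (memLp_four_of_tail hβ hκ (hA.measurable i j) (hA.tail i j)).1
  have h2 : ∀ i j, ∫ ω, A ω i j ^ 2 ∂μ = 1 := fun i j => by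
    rw [← hA.variance_one i j,
      variance_of_integral_eq_zero (hA.measurable i j).aemeasurable (hA.mean_zero i j)]
  have key : ∀ i, _ := fun i => sum_moments (μ := μ) (X := fun j ω => A ω i j * z j)
    (v := fun j => z j ^ 2) hB (fun j => (hA.measurable i j).mul_const _)
    (fun j => (h4 i j).mul_const (z j))
    ((hA.indep.precomp (g := fun j => (i, j)) fun _ _ hab => (Prod.ext_iff.1 hab).2).comp
      (fun j x => x * z j) (fun j => by fun_prop))
    (fun j => by rw [integral_mul_const, hA.mean_zero, zero_mul])
    (fun j => by simp_rw [mul_pow]; rw [integral_mul_const, h2, one_mul])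
    (fun j => by
      simp_rw [mul_pow]
      rw [integral_mul_const, ← pow_mul]
      have := (memLp_four_of_tail hβ hκ (hA.measurable i j) (hA.tail i j)).2
      gcongr
      linarith)
    Finset.univ
  have hind : iIndepFun (fun i ω => ∑ j, A ω i j * z j) μ :=
    (iIndepFun_rows (X := fun i j ω => A ω i j) hA.measurable hA.indep).comp
      (fun _ r => ∑ j, r j * z j) (fun _ => by fun_prop)
  have hm := hA.measurable
  have := measure_sum_sq_le (N := N) hv (by linarith) (fun i => by fun_prop) (fun i => (key i).1)
    hind (fun i => (key i).2.2.1) (fun i => (key i).2.2.2)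
  refine le_trans (measureReal_mono fun ω hω => ?_) this
  simp only [Set.mem_ofPred_eq] at hω ⊢
  exact hω.le

/-- Union bound over the d columns and the (2d)^(mK+1) choices of signed basis vectors. -/
lemma IsSubGaussianMatrix.measure_not_spread_le [IsProbabilityMeasure μ] {β κ : ℝ} (hβ : 0 < β)
    (hκ : 0 < κ) {N d : ℕ} {A : Ω → Matrix (Fin N) (Fin d) ℝ} (hA : IsSubGaussianMatrix μ β κ A)
    (hN : 0 < N) (K : ℕ) {m : ℕ} (hm : 128 * (2 * (β + 1) / κ) ≤ m) :
    μ.real {ω | ¬ Spread K (A ω)} ≤ d * Real.exp (-N) +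
      (2 * d) ^ (m * K + 1) * Real.exp (-(N / (8 * (3 + 8 / κ ^ 2 * (1 + β))))) := by
  have hsub : {ω | ¬ Spread K (A ω)} ⊆
      (⋃ j, {ω | 2 * (β + 1) / κ * N ≤ ∑ i, A ω i j ^ 2}) ∪
        ⋃ f : Fin (m * K + 1) → Fin d × Bool,
          {ω | ∑ i, (A ω).mulVec (signedSum f) i ^ 2 < N / 2 * ∑ j, signedSum f j ^ 2} := by
    intro ω hω
    by_contra hc
    simp only [Set.mem_union, Set.mem_iUnion, Set.mem_ofPred_eq, not_or, not_exists, not_le,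
      not_lt] at hc
    exact hω (spread_of_signedSum hN (by positivity) hm (fun j => (hc.1 j).le) hc.2)
  refine (measureReal_mono hsub).trans ((measureReal_union_le _ _).trans (add_le_add ?_ ?_))
  · refine (measureReal_iUnion_fintype_le _).trans
      ((Finset.sum_le_sum fun j _ => hA.measure_column_le hβ hκ j).trans_eq ?_)
    simp
  · refine (measureReal_iUnion_fintype_le _).trans
      ((Finset.sum_le_sum fun f _ => hA.measure_mulVec_le hβ hκ _).trans_eq ?_)
    simp [mul_comm]

/-- With enough samples the kernel of a sub-Gaussian matrix is spread with high probability. -/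
lemma exists_measure_not_spread_lt {β κ : ℝ} (hβ : 0 < β) (hκ : 0 < κ) :
    ∃ C : ℝ, 2 ≤ C ∧ ∀ (d K N : ℕ) (ε : ℝ), 2 ≤ d → 0 < ε → ε < 1 →
      C * K * (Real.log d + Real.log (1 / ε)) ≤ N →
      ∀ (Ω : Type*) [MeasurableSpace Ω] (μ : Measure Ω) [IsProbabilityMeasure μ]
        (A : Ω → Matrix (Fin N) (Fin d) ℝ), IsSubGaussianMatrix μ β κ A →
        μ.real {ω | ¬ Spread K (A ω)} < ε / 2 := by
  obtain ⟨m, hm⟩ := exists_nat_ge (128 * (2 * (β + 1) / κ))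
  set b : ℝ := 8 * (3 + 8 / κ ^ 2 * (1 + β)) with hb
  have hb1 : 1 ≤ b := by
    have : 0 ≤ 8 / κ ^ 2 * (1 + β) := by positivity
    linarith
  -- The logarithm of the number of sums is at most (mK + 1)·2L and log(4/ε) ≤ 2L, so 2m + 4 would
  -- balance them; 5 gives strictness.
  refine ⟨(2 * m + 5) * b, by nlinarith [Nat.cast_nonneg (α := ℝ) m], ?_⟩
  intro d K N ε hd hε hε1 hN Ω _ μ _ A hA
  rcases Nat.eq_zero_or_pos K with rfl | hK
  -- K = 0 permits N = 0, but then the property holds trivially.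
  · have : {ω | ¬ Spread 0 (A ω)} = ∅ := by
      ext ω
      simp only [Set.mem_ofPred_eq, Set.mem_empty_iff_false, iff_false, not_not]
      intro h _
      simp [sq_nonneg]
    rw [this]
    simp [hε]
  have hdr : (2 : ℝ) ≤ d := by exact_mod_cast hd
  have hK1 : (1 : ℝ) ≤ K := by exact_mod_cast hK
  have hl2 : Real.log 2 ≤ Real.log d := Real.log_le_log (by norm_num) hdr
  have hl2p : 0 < Real.log 2 := Real.log_pos (by norm_num)
  have hle : Real.log (1 / ε) = -Real.log ε := by rw [one_div, Real.log_inv]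
  have hlep : Real.log ε < 0 := Real.log_neg hε hε1
  rw [hle] at hN
  set L := Real.log d + -Real.log ε with hL
  have hLp : 0 < L := by linarith
  have hKL : L ≤ K * L := by nlinarith
  have hm0 : (0 : ℝ) ≤ m := Nat.cast_nonneg m
  have hNb : (2 * m + 5) * (K * L) ≤ N / b := by
    rw [le_div_iff₀ (by linarith)]; linarith
  have hmKL : 0 ≤ m * (K * L) := by positivity
  have hN1 : (N : ℝ) / b ≤ N := div_le_self (Nat.cast_nonneg N) hb1
  have hNpos : 0 < N := by
    have : (0 : ℝ) < N := by linarith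
    exact_mod_cast this
  have hlog4 : Real.log (ε / 4) = Real.log ε - 2 * Real.log 2 := by
    rw [Real.log_div hε.ne' (by norm_num), show (4 : ℝ) = 2 ^ 2 by norm_num, Real.log_pow]
    push_cast; ring
  have t1 : d * Real.exp (-N) < ε / 4 := by
    rw [← Real.log_lt_log_iff (by positivity) (by positivity), Real.log_mul (by positivity)
      (Real.exp_ne_zero _), Real.log_exp, hlog4]
    linarith
  have t2 : (2 * d) ^ (m * K + 1) * Real.exp (-(N / b)) < ε / 4 := by
    rw [← Real.log_lt_log_iff (by positivity) (by positivity), Real.log_mul (by positivity)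
      (Real.exp_ne_zero _), Real.log_exp, hlog4, Real.log_pow,
      Real.log_mul (by norm_num) (by positivity)]
    push_cast
    have h1 : (m * K + 1 : ℝ) * (Real.log 2 + Real.log d) ≤ (m * K + 1) * (2 * L) := by
      gcongr
      linarith
    linarith
  have := hA.measure_not_spread_le hβ hκ hNpos K hm
  linarith

end Probability

/-! ### Deterministic exact recovery from spread kernels. -/

section Recovery

lemma l1Norm_add_le {d : ℕ} (x y : Fin d → ℝ) : l1Norm (x + y) ≤ l1Norm x + l1Norm y := by
  simp only [l1Norm, ← Finset.sum_add_distrib]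
  exact Finset.sum_le_sum fun j _ => abs_add_le _ _

/-- Perturbing a vector supported in `S` by `h` increases its `ℓ¹` norm by at least the excess of
the mass of `h` outside `S` over the mass inside. -/
lemma l1Norm_add_ge {d : ℕ} (u h : Fin d → ℝ) :
    l1Norm u + l1Norm h - 2 * ∑ j ∈ Finset.univ.filter fun j => u j ≠ 0, |h j| ≤
      l1Norm (u + h) := by
  simp only [l1Norm, Finset.sum_filter, Finset.mul_sum, ← Finset.sum_add_distrib,
    ← Finset.sum_sub_distrib]
  refine Finset.sum_le_sum fun j _ => ?_
  by_cases hj : u j = 0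
  · simp [hj]
  · rw [if_pos hj, Pi.add_apply]
    have := abs_sub_abs_le_abs_sub (u j) (-h j)
    rw [abs_neg, sub_neg_eq_add] at this
    linarith

lemma Spread.sum_abs_le {N d K : ℕ} {A : Matrix (Fin N) (Fin d) ℝ} (hA : Spread K A)
    {h : Fin d → ℝ} (hh : A.mulVec h = 0) {S : Finset (Fin d)} {t : ℕ}
    (hS : t ^ 2 * S.card ≤ K) : 8 * t * ∑ j ∈ S, |h j| ≤ l1Norm h := by
  refine le_of_sq_le_sq ?_ (l1Norm_nonneg h)
  have h1 := sq_sum_le_card_mul_sum_sq (s := S) (f := fun j => |h j|)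
  simp only [sq_abs] at h1
  have h2 : ∑ j ∈ S, h j ^ 2 ≤ ∑ j, h j ^ 2 :=
    Finset.sum_le_sum_of_subset_of_nonneg (Finset.subset_univ _) fun _ _ _ => sq_nonneg _
  have hS' : (t : ℝ) ^ 2 * S.card ≤ K := by exact_mod_cast hS
  calc (8 * t * ∑ j ∈ S, |h j|) ^ 2 = 64 * ((t : ℝ) ^ 2 * (∑ j ∈ S, |h j|) ^ 2) := by ring
    _ ≤ 64 * ((t : ℝ) ^ 2 * (S.card * ∑ j, h j ^ 2)) := by
        gcongr
        exact h1.trans (by gcongr)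
    _ = 64 * (((t : ℝ) ^ 2 * S.card) * ∑ j, h j ^ 2) := by ring
    _ ≤ 64 * (K * ∑ j, h j ^ 2) := by gcongr
    _ ≤ _ := by linarith [hA h hh]

lemma edgeVariation_mk {n d : ℕ} (x : Fin n → Fin d → ℝ) (v w : Fin n) :
    edgeVariation x s(v, w) = l1Norm (x v - x w) := rfl

lemma edgeVariation_nonneg {n d : ℕ} (x : Fin n → Fin d → ℝ) (e : Sym2 (Fin n)) :
    0 ≤ edgeVariation x e := by
  induction e with | _ v w => exact l1Norm_nonneg _

lemma add_sub_add_comm' {n d : ℕ} (x h : Fin n → Fin d → ℝ) (v w : Fin n) :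
    (x + h) v - (x + h) w = (x v - x w) + (h v - h w) := by
  simp only [Pi.add_apply]; abel

/-- The change of the variation along an edge that does not contain the root. -/
lemma edgeVariation_add_ge_of_spread {n d N t K : ℕ} {A : Matrix (Fin N) (Fin d) ℝ}
    (hA : Spread K A) {x h : Fin n → Fin d → ℝ} {v w : Fin n} (ht : 1 ≤ t)
    (hv : A.mulVec (h v) = 0) (hw : A.mulVec (h w) = 0)
    (hS : t ^ 2 * suppCard (x v - x w) ≤ K) :
    edgeVariation x s(v, w) + 3 / 4 * edgeVariation h s(v, w) ≤
      edgeVariation (x + h) s(v, w) := by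
  simp only [edgeVariation_mk, add_sub_add_comm']
  have h1 := l1Norm_add_ge (x v - x w) (h v - h w)
  -- Both ends share one matrix, so the difference is itself in the kernel and t = 1 suffices: the
  -- loss is 2/8 of its norm.
  have h2 := hA.sum_abs_le (h := h v - h w) (t := 1)
    (by rw [Matrix.mulVec_sub, hv, hw, sub_zero])
    (S := Finset.univ.filter fun j => (x v - x w) j ≠ 0)
    (by
      refine le_trans ?_ hS
      exact Nat.mul_le_mul_right _ (Nat.pow_le_pow_left ht 2))
  push_cast at h2
  linarith

/-- The change of the variation along an edge that contains the root. -/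
lemma edgeVariation_add_ge_of_root {n d N₀ N t K₀ K : ℕ} {A₀ : Matrix (Fin N₀) (Fin d) ℝ}
    {A : Matrix (Fin N) (Fin d) ℝ} (hA₀ : Spread K₀ A₀) (hA : Spread K A)
    {x h : Fin n → Fin d → ℝ} {v w : Fin n} (ht : 1 ≤ t)
    (hv : A₀.mulVec (h v) = 0) (hw : A.mulVec (h w) = 0)
    (hS₀ : t ^ 2 * suppCard (x v - x w) ≤ K₀) (hS : t ^ 2 * suppCard (x v - x w) ≤ K) :
    edgeVariation x s(v, w) + 3 / 4 * edgeVariation h s(v, w) - 1 / (2 * t) * l1Norm (h v) ≤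
      edgeVariation (x + h) s(v, w) := by
  simp only [edgeVariation_mk, add_sub_add_comm']
  have h1 := l1Norm_add_ge (x v - x w) (h v - h w)
  set S := Finset.univ.filter fun j => (x v - x w) j ≠ 0
  have htr : (1 : ℝ) ≤ t := by exact_mod_cast ht
  -- The difference need not lie in either kernel, so the ends are bounded separately and `h w` is
  -- then compared with `h v` by the triangle inequality.
  have h2 := hA₀.sum_abs_le hv (S := S) hS₀
  have h3 := hA.sum_abs_le hw (S := S) hS
  have h4 : ∑ j ∈ S, |(h v - h w) j| ≤ ∑ j ∈ S, |h v j| + ∑ j ∈ S, |h w j| := by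
    rw [← Finset.sum_add_distrib]
    exact Finset.sum_le_sum fun j _ => abs_sub _ _
  have h5 : l1Norm (h w) ≤ l1Norm (h v) + l1Norm (h v - h w) := by
    have := l1Norm_add_le (h v) (-(h v - h w))
    have e : l1Norm (-(h v - h w)) = l1Norm (h v - h w) := by simp [l1Norm, abs_sub_comm]
    rw [e] at this
    simpa using this
  have h6 : 2 * ∑ j ∈ S, |(h v - h w) j| ≤
      1 / (4 * t) * (2 * l1Norm (h v) + l1Norm (h v - h w)) := by
    rw [div_mul_eq_mul_div, le_div_iff₀ (by positivity)]
    nlinarith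
  have h7 : 1 / (4 * (t : ℝ)) * l1Norm (h v - h w) ≤ 1 / 4 * l1Norm (h v - h w) := by
    refine mul_le_mul_of_nonneg_right ?_ (l1Norm_nonneg _)
    rw [div_le_div_iff₀ (by positivity) (by norm_num)]
    linarith
  have h8 : 1 / (2 * (t : ℝ)) * l1Norm (h v) = 1 / (4 * t) * (2 * l1Norm (h v)) := by
    field_simp; ring
  linarith

lemma design_mulVec_eq_zero_root {n d : ℕ} [NeZero n] {NRoot NNonRoot : ℕ}
    {ARoot : Matrix (Fin NRoot) (Fin d) ℝ} {ANonRoot : Matrix (Fin NNonRoot) (Fin d) ℝ}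
    {h : Fin d → ℝ} (hh : (design (n := n) ARoot ANonRoot 0).mulVec h = 0) :
    ARoot.mulVec h = 0 := by
  ext i
  -- A row index forces a positive sample size, so the scaling 1/√N can be cancelled.
  have hN : 0 < NRoot := i.pos
  have := congrFun hh (Fin.cast (by simp [sampleSize]) i)
  simp only [Matrix.mulVec, dotProduct, design, dif_pos, Fin.cast_cast, Fin.cast_eq_self,
    Pi.zero_apply, mul_assoc, ← Finset.mul_sum] at this ⊢
  exact (mul_eq_zero.1 this).resolve_left (by positivity)

lemma design_mulVec_eq_zero_nonRoot {n d : ℕ} [NeZero n] {NRoot NNonRoot : ℕ}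
    {ARoot : Matrix (Fin NRoot) (Fin d) ℝ} {ANonRoot : Matrix (Fin NNonRoot) (Fin d) ℝ}
    {h : Fin d → ℝ} {v : Fin n} (hv : v ≠ 0) (hh : (design ARoot ANonRoot v).mulVec h = 0) :
    ANonRoot.mulVec h = 0 := by
  ext i
  have hN : 0 < NNonRoot := i.pos
  have := congrFun hh (Fin.cast (by simp [sampleSize, hv]) i)
  simp only [Matrix.mulVec, dotProduct, design, dif_neg hv, Fin.cast_cast, Fin.cast_eq_self,
    Pi.zero_apply, mul_assoc, ← Finset.mul_sum] at this ⊢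
  exact (mul_eq_zero.1 this).resolve_left (by positivity)

variable {n d s s' : ℕ} [NeZero n] {G : SimpleGraph (Fin n)} [DecidableRel G.Adj]

/-- The objective grows by a fixed fraction of its value at the perturbation. -/
lemma objective_add_ge {NRoot NNonRoot : ℕ} {ARoot : Matrix (Fin NRoot) (Fin d) ℝ}
    {ANonRoot : Matrix (Fin NNonRoot) (Fin d) ℝ} (hG : G.Connected)
    (hR : Spread (max s (G.degree 0 ^ 2 * s')) ARoot) (hNR : Spread (G.degree 0 ^ 2 * s') ANonRoot)
    {x h : Fin n → Fin d → ℝ} (hx : IsSparse G s s' x) (h0 : ARoot.mulVec (h 0) = 0)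
    (h1 : ∀ v, v ≠ 0 → ANonRoot.mulVec (h v) = 0) :
    objective G x + 1 / 4 * objective G h ≤ objective G (x + h) := by
  have hroot : l1Norm (x 0) + 3 / 4 * l1Norm (h 0) ≤ l1Norm ((x + h) 0) := by
    have e1 := l1Norm_add_ge (x 0) (h 0)
    have e2 := hR.sum_abs_le h0 (t := 1) (S := Finset.univ.filter fun j => x 0 j ≠ 0)
      (by
        rw [one_pow, one_mul]
        exact hx.1.trans (le_max_left _ _))
    push_cast at e2
    rw [Pi.add_apply]
    linarith
  -- The edge estimates take t to be the root degree and need t ≥ 1; without edges there is nothing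
  -- to estimate.
  have hdeg : G.edgeSet.Nonempty → 1 ≤ G.degree 0 := by
    rintro ⟨e, he⟩
    induction e with | _ v w =>
    have hvw : G.Adj v w := he
    have : Nontrivial (Fin n) := ⟨v, w, hvw.ne⟩
    exact hG.preconnected.degree_pos_of_nontrivial 0
  have hedge : ∀ e ∈ G.edgeFinset, edgeVariation x e + 3 / 4 * edgeVariation h e -
      (if (0 : Fin n) ∈ e then 1 / (2 * (G.degree 0 : ℝ)) * l1Norm (h 0) else 0) ≤
      edgeVariation (x + h) e := by
    intro e he
    rw [SimpleGraph.mem_edgeFinset] at he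
    have hd1 := hdeg ⟨e, he⟩
    have hroot_edge : ∀ w, G.Adj 0 w → edgeVariation x s(0, w) + 3 / 4 * edgeVariation h s(0, w) -
        1 / (2 * (G.degree 0 : ℝ)) * l1Norm (h 0) ≤ edgeVariation (x + h) s(0, w) := by
      intro w hw
      have hs : G.degree 0 ^ 2 * suppCard (x 0 - x w) ≤ G.degree 0 ^ 2 * s' :=
        Nat.mul_le_mul_left _ (hx.2 _ _ hw)
      exact edgeVariation_add_ge_of_root hR hNR hd1 h0 (h1 w hw.ne')
        (hs.trans (le_max_right _ _)) hs
    induction e with | _ v w =>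
    have hvw : G.Adj v w := he
    by_cases hv : v = 0
    · subst hv
      rw [if_pos (Sym2.mem_mk_left _ _)]
      exact hroot_edge w hvw
    by_cases hw : w = 0
    · subst hw
      rw [if_pos (Sym2.mem_mk_right _ _), Sym2.eq_swap]
      exact hroot_edge v hvw.symm
    rw [if_neg (by simp [Sym2.mem_iff, Ne.symm hv, Ne.symm hw]), sub_zero]
    exact edgeVariation_add_ge_of_spread hNR hd1 (h1 v hv) (h1 w hw)
      (Nat.mul_le_mul_left _ (hx.2 _ _ hvw))
  have hsum := Finset.sum_le_sum hedge
  rw [Finset.sum_sub_distrib, Finset.sum_add_distrib, ← Finset.mul_sum, ← Finset.sum_filter,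
    ← SimpleGraph.incidenceFinset_eq_filter, Finset.sum_const,
    SimpleGraph.card_incidenceFinset_eq_degree, nsmul_eq_mul] at hsum
  -- The root edges together charge at most half of ‖h₀‖₁, which leaves 3/4 - 1/2 = 1/4 at the root.
  have hinc : (G.degree 0 : ℝ) * (1 / (2 * (G.degree 0 : ℝ)) * l1Norm (h 0)) ≤
      1 / 2 * l1Norm (h 0) := by
    rcases Nat.eq_zero_or_pos (G.degree 0) with hz | hz
    · rw [hz]; simpa using l1Norm_nonneg _
    · have : (0 : ℝ) < G.degree 0 := by exact_mod_cast hz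
      exact le_of_eq (by field_simp)
  have hnn : 0 ≤ ∑ e ∈ G.edgeFinset, edgeVariation h e :=
    Finset.sum_nonneg fun e _ => edgeVariation_nonneg h e
  simp only [objective]
  linarith

/-- All terms vanish, so h is zero at the root and constant along walks. -/
lemma eq_zero_of_objective_le_zero (hG : G.Connected) {h : Fin n → Fin d → ℝ}
    (hh : objective G h ≤ 0) : h = 0 := by
  have hnn : 0 ≤ ∑ e ∈ G.edgeFinset, edgeVariation h e :=
    Finset.sum_nonneg fun e _ => edgeVariation_nonneg h e
  have h0 := l1Norm_nonneg (h 0)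
  simp only [objective] at hh
  have hr : h 0 = 0 := l1Norm_eq_zero.1 (by linarith)
  have he := (Finset.sum_eq_zero_iff_of_nonneg fun e _ => edgeVariation_nonneg h e).1
    (show ∑ e ∈ G.edgeFinset, edgeVariation h e = 0 by linarith)
  have hadj : ∀ v w, G.Adj v w → h v = h w := fun v w hvw =>
    sub_eq_zero.1 (l1Norm_eq_zero.1 (he s(v, w) (SimpleGraph.mem_edgeFinset.2 hvw)))
  funext v
  obtain ⟨p⟩ := hG.preconnected v 0
  suffices ∀ u w, G.Walk u w → h u = h w by rw [this v 0 p, hr]; rfl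
  intro u w p
  induction p with
  | nil => rfl
  | cons hvw _ ih => exact (hadj _ _ hvw).trans ih

/-- Exact recovery by TVBP when the kernels of the design matrices are spread. -/
lemma isSolution_iff_of_spread {NRoot NNonRoot : ℕ} {ARoot : Matrix (Fin NRoot) (Fin d) ℝ}
    {ANonRoot : Matrix (Fin NNonRoot) (Fin d) ℝ} (hG : G.Connected)
    (hR : Spread (max s (G.degree 0 ^ 2 * s')) ARoot) (hNR : Spread (G.degree 0 ^ 2 * s') ANonRoot)
    {xStar : Fin n → Fin d → ℝ} (hx : IsSparse G s s' xStar) (x : Fin n → Fin d → ℝ) :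
    IsSolution G (design ARoot ANonRoot)
      (fun v => (design ARoot ANonRoot v).mulVec (xStar v)) x ↔ x = xStar := by
  have key : ∀ z, IsFeasible (design ARoot ANonRoot)
      (fun v => (design ARoot ANonRoot v).mulVec (xStar v)) z →
      objective G xStar + 1 / 4 * objective G (z - xStar) ≤ objective G z := by
    intro z hz
    have hker : ∀ v, (design ARoot ANonRoot v).mulVec ((z - xStar) v) = 0 := fun v => by
      rw [Pi.sub_apply, Matrix.mulVec_sub, hz v, sub_self]
    have := objective_add_ge hG hR hNR (h := z - xStar) hx
      (design_mulVec_eq_zero_root (hker 0))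
      (fun v hv => design_mulVec_eq_zero_nonRoot hv (hker v))
    rwa [add_sub_cancel] at this
  have hnn : ∀ h : Fin n → Fin d → ℝ, 0 ≤ objective G h := fun h =>
    add_nonneg (l1Norm_nonneg _) (Finset.sum_nonneg fun e _ => edgeVariation_nonneg h e)
  constructor
  · rintro ⟨hf, hmin⟩
    have h1 := key x hf
    have h2 := hmin xStar fun _ => rfl
    exact sub_eq_zero.1 (eq_zero_of_objective_le_zero hG (by linarith))
  · rintro rfl
    exact ⟨fun _ => rfl, fun z hz => by linarith [key z hz, hnn (z - x)]⟩

end Recovery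

/-! ### Rounding of the sample sizes, and the theorem. -/

lemma ceil_mul_le_two_mul {C L : ℝ} (hC : 2 ≤ C) (hL : Real.log 2 ≤ L) (K : ℕ) :
    (⌈C * K * L⌉₊ : ℝ) ≤ 2 * C * K * L := by
  rcases Nat.eq_zero_or_pos K with rfl | hK
  · simp
  have hK1 : (1 : ℝ) ≤ K := by exact_mod_cast hK
  have h2 : (1 : ℝ) / 2 ≤ L := by linarith [Real.log_two_gt_d9]
  have hCK : 2 ≤ C * K := by nlinarith
  -- Rounding up a number that is at least 1 at most doubles it.
  have h1 : 1 ≤ C * K * L := by nlinarith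
  linarith [(Nat.ceil_lt_add_one (by linarith : 0 ≤ C * K * L)).le]

end TVBP

theorem theorem4 (β κ : ℝ) (hβ : 0 < β) (hκ : 0 < κ) :
    ∃ C : ℝ, 0 < C ∧ ∃ C' : ℝ, 0 < C' ∧
      ∀ (n : ℕ) [NeZero n] (G : SimpleGraph (Fin n)) [DecidableRel G.Adj], G.IsTree →
      ∀ (d s s' : ℕ), 2 ≤ d →
      ∀ ε : ℝ, 0 < ε → ε < 1 →
        -- exact recovery with high probability
        (∀ NRoot NNonRoot : ℕ, TVBP.SampleSizesSuffice C G d s s' ε NRoot NNonRoot →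
          ∀ (Ω : Type*) [MeasurableSpace Ω] (μ : Measure Ω) [IsProbabilityMeasure μ]
            (ARoot : Ω → Matrix (Fin NRoot) (Fin d) ℝ)
            (ANonRoot : Ω → Matrix (Fin NNonRoot) (Fin d) ℝ),
          TVBP.IsSubGaussianMatrix μ β κ ARoot →
          TVBP.IsSubGaussianMatrix μ β κ ANonRoot →
          ∀ xStar : Fin n → Fin d → ℝ, TVBP.IsSparse G s s' xStar →
            1 - ε < μ.real {ω | ∀ x : Fin n → Fin d → ℝ,
              TVBP.IsSolution G (TVBP.design (ARoot ω) (ANonRoot ω))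
                (fun v => (TVBP.design (ARoot ω) (ANonRoot ω) v).mulVec (xStar v)) x ↔
              x = xStar}) ∧
        -- the total number of samples that suffices
        (∃ NRoot NNonRoot : ℕ, TVBP.SampleSizesSuffice C G d s s' ε NRoot NNonRoot ∧
          ∑ v : Fin n, (TVBP.sampleSize NRoot NNonRoot v : ℝ) ≤
            C' * (s + n * (G.degree 0 : ℝ) ^ 2 * s') * (Real.log d + Real.log (1 / ε))) := by
  obtain ⟨C, hC, hP⟩ := TVBP.exists_measure_not_spread_lt hβ hκ
  refine ⟨C, by linarith, 2 * C, by linarith, ?_⟩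
  intro n _ G _ hG d s s' hd ε hε hε1
  constructor
  · intro NRoot NNonRoot hN Ω _ μ _ ARoot ANonRoot hAR hANR xStar hx
    have hR := hP d (max s (G.degree 0 ^ 2 * s')) NRoot ε hd hε hε1
      (by push_cast; exact hN.1) Ω μ ARoot hAR
    have hNR := hP d (G.degree 0 ^ 2 * s') NNonRoot ε hd hε hε1
      (by push_cast; exact hN.2) Ω μ ANonRoot hANR
    set good := {ω | ∀ x : Fin n → Fin d → ℝ,
      TVBP.IsSolution G (TVBP.design (ARoot ω) (ANonRoot ω))
        (fun v => (TVBP.design (ARoot ω) (ANonRoot ω) v).mulVec (xStar v)) x ↔ x = xStar}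
      with hgood
    -- Subadditivity requires neither measurability of `good` nor anything on the joint law; each
    -- bad event has measure below ε/2.
    have hcover : Set.univ ⊆ good ∪
        ({ω | ¬ TVBP.Spread (max s (G.degree 0 ^ 2 * s')) (ARoot ω)} ∪
          {ω | ¬ TVBP.Spread (G.degree 0 ^ 2 * s') (ANonRoot ω)}) := by
      intro ω _
      by_contra hc
      simp only [Set.mem_union, Set.mem_ofPred_eq, not_or, not_not] at hc
      exact hc.1 fun x => TVBP.isSolution_iff_of_spread hG.connected hc.2.1 hc.2.2 hx x
    have h1 := measureReal_mono (μ := μ) hcover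
    have h2 := measureReal_union_le (μ := μ) good
      ({ω | ¬ TVBP.Spread (max s (G.degree 0 ^ 2 * s')) (ARoot ω)} ∪
          {ω | ¬ TVBP.Spread (G.degree 0 ^ 2 * s') (ANonRoot ω)})
    have h3 := measureReal_union_le (μ := μ)
      {ω | ¬ TVBP.Spread (max s (G.degree 0 ^ 2 * s')) (ARoot ω)}
      {ω | ¬ TVBP.Spread (G.degree 0 ^ 2 * s') (ANonRoot ω)}
    rw [probReal_univ] at h1
    linarith
  · set L := Real.log d + Real.log (1 / ε) with hL
    have hL2 : Real.log 2 ≤ L := by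
      have h1 : Real.log 2 ≤ Real.log d := Real.log_le_log (by norm_num) (by exact_mod_cast hd)
      have h2 : 0 ≤ Real.log (1 / ε) := Real.log_nonneg (by rw [le_div_iff₀ hε]; linarith)
      linarith
    have hL0 : 0 ≤ L := (Real.log_nonneg (by norm_num)).trans hL2
    set K₁ := max s (G.degree 0 ^ 2 * s') with hK₁
    set K₂ := G.degree 0 ^ 2 * s' with hK₂
    refine ⟨⌈C * K₁ * L⌉₊, ⌈C * K₂ * L⌉₊, ⟨?_, ?_⟩, ?_⟩
    · have := Nat.le_ceil (C * K₁ * L)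
      rw [hK₁, hK₂] at this ⊢
      push_cast at this ⊢
      exact this
    · have := Nat.le_ceil (C * K₂ * L)
      rw [hK₂] at this ⊢
      push_cast at this ⊢
      exact this
    · have b1 := TVBP.ceil_mul_le_two_mul hC hL2 K₁
      have b2 := TVBP.ceil_mul_le_two_mul hC hL2 K₂
      -- The root's share of `K₂` joins those of the n - 1 other nodes to give n `K₂`.
      have hK : (K₁ : ℝ) ≤ s + K₂ := by
        have : K₁ ≤ s + K₂ := max_le (Nat.le_add_right _ _) (Nat.le_add_left _ _)
        exact_mod_cast this
      have hn : (1 : ℝ) ≤ n := by exact_mod_cast NeZero.one_le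
      have hsum : ∑ v : Fin n, (TVBP.sampleSize ⌈C * K₁ * L⌉₊ ⌈C * K₂ * L⌉₊ v : ℝ) =
          ⌈C * K₁ * L⌉₊ + (n - 1) * ⌈C * K₂ * L⌉₊ := by
        rw [← Finset.add_sum_erase _ _ (Finset.mem_univ (0 : Fin n)),
          Finset.sum_congr rfl fun v hv => by
            rw [TVBP.sampleSize, if_neg (Finset.ne_of_mem_erase hv)],
          Finset.sum_const, Finset.card_erase_of_mem (Finset.mem_univ _), Finset.card_univ,
          Fintype.card_fin, nsmul_eq_mul, Nat.cast_sub NeZero.one_le]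
        simp [TVBP.sampleSize]
      have hK₂r : (K₂ : ℝ) = (G.degree 0 : ℝ) ^ 2 * s' := by rw [hK₂]; push_cast; ring
      rw [hsum]
      calc _ ≤ 2 * C * K₁ * L + (n - 1) * (2 * C * K₂ * L) := by
            have : (0 : ℝ) ≤ n - 1 := by linarith
            gcongr
        _ ≤ 2 * C * (s + K₂) * L + (n - 1) * (2 * C * K₂ * L) := by gcongr
        _ = _ := by rw [hK₂r]; ring
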